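/- Let $I\subseteq\mathbb R$ be an interval and let $\gamma=(\gamma_t)_{t\in I}$ be a motion of Euclidean 4-space $E^4$, i.e. a continuous curve in $SE(4)$, such that the trajectory $\{\gamma_t(p): t\in I\}$ of every point $p\in E^4$ lies on a circle of positive radius (arcs, and points that stay at rest, are allowed); such a motion is called a circular Darboux 2-motion. Assume that $\gamma$ is not spherical (no point $p$ has a constant position $\gamma_t(p)$) and is not a pure translation (the linear part of $\gamma_t$ is not constant in $t$). Then $\gamma$ is composed of a rotation about a fixed plane and a circular translation parallel to this plane: there are a 2-dimensional affine plane $P\subset E^4$, a fixed displacement $g\in SE(4)$ (the choice of the moving frame), a nonconstant continuous motion $\rho_t\in SE(4)$ ($t\in I$) fixing every point of $P$, and a nonconstant continuous motion $\sigma_t$ ($t\in I$) consisting of translations by vectors in the direction space of $P$, under which every point moves on a circle of positive radius, such that $\gamma_t=\sigma_t\circ\rho_t\circ g$ for all $t\in I$. -/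

import Mathlib

/-- Euclidean 4-space. -/
abbrev E4 : Type := EuclideanSpace ℝ (Fin 4)

namespace Kinematics

/-- A displacement of `E4`, i.e. an element of SE(4): an isometry whose linear part has
determinant `1`. -/
def IsDisplacement (f : E4 ≃ᵃⁱ[ℝ] E4) : Prop :=
  LinearMap.det (f.linearIsometryEquiv.toLinearEquiv : E4 →ₗ[ℝ] E4) = 1

/-- A motion with parameter interval `I`: a continuous curve of displacements. The moving point
`p` has position `γ t p` at time `t`. (Pointwise continuity is continuity in SE(4).) -/
structure IsMotionOn (γ : ℝ → E4 ≃ᵃⁱ[ℝ] E4) (I : Set ℝ) : Prop where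
  displacement : ∀ t ∈ I, IsDisplacement (γ t)
  continuousOn : ∀ p : E4, ContinuousOn (fun t => γ t p) I

/-- The trajectory of the point `p`. -/
def trajectory (γ : ℝ → E4 ≃ᵃⁱ[ℝ] E4) (I : Set ℝ) (p : E4) : Set E4 :=
  (fun t => γ t p) '' I

/-- A circle of positive radius `r` with center `c` in the plane through `c` with direction
space `D`. -/
def IsCircle (C : Set E4) : Prop :=
  ∃ (c : E4) (D : Submodule ℝ E4) (r : ℝ),
    Module.finrank ℝ D = 2 ∧ 0 < r ∧ C = {x : E4 | x - c ∈ D ∧ dist x c = r}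

/-- All points move on circles. Arcs and points at rest are allowed, so that rotations about a
plane are included. -/
def HasCircularTrajectories (γ : ℝ → E4 ≃ᵃⁱ[ℝ] E4) (I : Set ℝ) : Prop :=
  ∀ p : E4, ∃ C : Set E4, IsCircle C ∧ trajectory γ I p ⊆ C

/-- A spherical motion: some point of the moving space stays at rest. -/
def IsSpherical (γ : ℝ → E4 ≃ᵃⁱ[ℝ] E4) (I : Set ℝ) : Prop :=
  ∃ p : E4, ∀ s ∈ I, ∀ t ∈ I, γ s p = γ t p

/-- A pure translation: the orientation does not change during the motion. -/
def IsPureTranslation (γ : ℝ → E4 ≃ᵃⁱ[ℝ] E4) (I : Set ℝ) : Prop :=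
  ∀ s ∈ I, ∀ t ∈ I, (γ s).linearIsometryEquiv = (γ t).linearIsometryEquiv

/-- The motion is not at rest. -/
def IsNonconstant (γ : ℝ → E4 ≃ᵃⁱ[ℝ] E4) (I : Set ℝ) : Prop :=
  ∃ s ∈ I, ∃ t ∈ I, γ s ≠ γ t

/-- A (nonconstant) rotation about the plane `P`: every displacement fixes `P` pointwise. -/
structure IsRotationAbout (ρ : ℝ → E4 ≃ᵃⁱ[ℝ] E4) (I : Set ℝ) (P : AffineSubspace ℝ E4) :
    Prop where
  motion : IsMotionOn ρ I
  fixes : ∀ t ∈ I, ∀ x ∈ P, ρ t x = x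
  nonconstant : IsNonconstant ρ I

/-- A (nonconstant) circular translation parallel to the plane `P`: every displacement is a
translation by a vector of the direction space of `P`, and all points move on circles. -/
structure IsCircularTranslationParallelTo (σ : ℝ → E4 ≃ᵃⁱ[ℝ] E4) (I : Set ℝ)
    (P : AffineSubspace ℝ E4) : Prop where
  motion : IsMotionOn σ I
  translation : ∀ t ∈ I, ∃ b ∈ P.direction, ∀ x : E4, σ t x = x + b
  circular : HasCircularTrajectories σ I
  nonconstant : IsNonconstant σ I

end Kinematics

/-!
Normalize the motion so that it starts with the identity at a time `t₀`, let `A t` be its linear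
part and `u t q` the displacement of the point `q` at time `t`, so that
`u t (q + w) = u t q + (A t - 1) w`. Circularity says that the displacements of a point span at
most a plane and lie on a sphere through the origin, and these two properties are inherited by the
linear motion `A t` (`IsCircularFamily.linear`).

The crucial remark is `IsCircularFamily.exists_subId_eq_smul`: if a moving point `p` is back at its
initial position at time `s`, then the displacements of the nearby points `p + ε w` are
`ε (A s - 1) w`. As the circles depend continuously on the point, `A s - 1` maps every `w` into the
tangent of the circle at `p`, so its rank is at most one. Since `A - 1` has even rank for every
rotation `A` (`even_finrank_range_subId`), `A s = 1`.

Now let `A s ≠ 1`. No point is at rest, so by the remark `A s - 1` is not invertible, hence its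
kernel `K` is a plane; by the remark for the linear motion, all `A t` fix `K` pointwise. Choose a
point `c` whose displacement at time `s` lies in `K`; it is nonzero by the remark once more. It
remains to see that `c` moves parallel to `K` (`IsCircularFamily.displacement_mem`). On the plane
`Kᗮ` the maps `A t - 1` are complex numbers. If the displacement of `c` at time `t` is not in `K`,
then comparing first order terms in the planarity condition at `c` shows that `u τ` is, on all
points, a fixed linear combination of `u s` and `u t`. The spheres through the trajectories of
`c ± x` then leave only the values `1`, `A s` and `A t` for `A τ`, which is impossible on an
interval. The motion is therefore composed of the rotations about the plane `c + K` and the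
translations by the displacements of `c`.
-/

open Module
open scoped RealInnerProductSpace

/-! ### Dependent triples and limits -/

theorem linearIndependent_triple_iff {F : Type*} [AddCommGroup F] [Module ℝ F] {x y z : F} :
    LinearIndependent ℝ ![x, y, z] ↔
      LinearIndependent ℝ ![y, z] ∧ x ∉ Submodule.span ℝ {y, z} := by
  have h := linearIndependent_finCons (K := ℝ) (x := x) (v := ![y, z])
  rw [Matrix.range_cons, Matrix.range_cons, Matrix.range_empty, Set.union_empty] at h
  exact h

theorem not_linearIndependent_triple_of_smul {F : Type*} [AddCommGroup F] [Module ℝ F]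
    {x y z : F} {a : ℝ} (ha : a ≠ 0) (h : ¬ LinearIndependent ℝ ![a • x, y, z]) :
    ¬ LinearIndependent ℝ ![x, y, z] := by
  rw [linearIndependent_triple_iff] at h ⊢
  rwa [Submodule.smul_mem_iff _ ha] at h

/-- Linear dependence of a triple is a closed condition, so it passes to the limit `ε → 0`. -/
theorem not_linearIndependent_triple_of_continuous {F : Type*} [NormedAddCommGroup F]
    [NormedSpace ℝ F] {a b c : ℝ → F} (ha : Continuous a) (hb : Continuous b)
    (hc : Continuous c) (h : ∀ ε : ℝ, ε ≠ 0 → ¬ LinearIndependent ℝ ![a ε, b ε, c ε]) :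
    ¬ LinearIndependent ℝ ![a 0, b 0, c 0] := by
  have hcont : Continuous fun ε => (![a ε, b ε, c ε] : Fin 3 → F) := by
    refine continuous_pi fun i => ?_
    fin_cases i <;> simpa
  have hclosed : IsClosed {ε : ℝ | ¬ LinearIndependent ℝ ![a ε, b ε, c ε]} :=
    ((isOpen_setOfPred_linearIndependent (𝕜 := ℝ)).preimage hcont).isClosed_compl
  have hdense : Dense ({0}ᶜ : Set ℝ) := dense_compl_singleton 0
  have := hclosed.closure_subset_iff.2 (fun ε hε => h ε hε : ({0}ᶜ : Set ℝ) ⊆ _)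
  exact this (hdense 0)

/-- If a plane `span {b ε, c ε}` depending continuously on `ε` contains `a ε` for `ε ≠ 0`, then
this also holds at `ε = 0`, provided that the plane does not degenerate there. -/
theorem exists_eq_smul_add_smul_of_continuous {F : Type*} [NormedAddCommGroup F]
    [NormedSpace ℝ F] {a b c : ℝ → F} (ha : Continuous a) (hb : Continuous b)
    (hc : Continuous c) (h : ∀ ε : ℝ, ε ≠ 0 → ¬ LinearIndependent ℝ ![a ε, b ε, c ε])
    (hbc : LinearIndependent ℝ ![b 0, c 0]) : ∃ r s : ℝ, a 0 = r • b 0 + s • c 0 := by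
  have := not_linearIndependent_triple_of_continuous ha hb hc h
  rw [linearIndependent_triple_iff] at this
  have h2 : a 0 ∈ Submodule.span ℝ {b 0, c 0} := by tauto
  obtain ⟨r, s, hrs⟩ := Submodule.mem_span_pair.1 h2
  exact ⟨r, s, hrs.symm⟩

/-- A continuous real function on an interval that takes finitely many values is constant. -/
theorem ContinuousOn.eq_of_finite_image {I : Set ℝ} (hI : I.OrdConnected) {f : ℝ → ℝ}
    (hf : ContinuousOn f I) {S : Set ℝ} (hS : S.Finite) (h : ∀ t ∈ I, f t ∈ S) {s t : ℝ}
    (hs : s ∈ I) (ht : t ∈ I) : f s = f t := by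
  by_contra hne
  have hpre : IsPreconnected (f '' I) := hI.isPreconnected.image f hf
  exact (hpre.infinite_of_nontrivial ⟨f s, ⟨s, hs, rfl⟩, f t, ⟨t, ht, rfl⟩, hne⟩)
    (hS.subset (by rintro _ ⟨r, hr, rfl⟩; exact h r hr))

/-! ### The rank of `A - 1` for a rotation `A` -/

section Rotation

variable {E : Type*} [NormedAddCommGroup E] [InnerProductSpace ℝ E]

/-- The linear map `A - 1`. -/
def subId (A : E ≃ₗᵢ[ℝ] E) : E →ₗ[ℝ] E := (A.toLinearEquiv : E →ₗ[ℝ] E) - LinearMap.id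

theorem subId_apply (A : E ≃ₗᵢ[ℝ] E) (v : E) : subId A v = A v - v := rfl

/-- The range of `A - 1` is orthogonal to the fixed vectors of an isometry `A`. -/
theorem inner_subId_of_fixed (A : E ≃ₗᵢ[ℝ] E) {k : E} (hk : subId A k = 0) (v : E) :
    ⟪k, subId A v⟫ = 0 := by
  have hk' : A k = k := sub_eq_zero.1 hk
  have := A.inner_map_map k v
  rw [hk'] at this
  rw [subId_apply, inner_sub_right, this, sub_self]

theorem two_mul_inner_subId (A : E ≃ₗᵢ[ℝ] E) (v : E) :
    ‖subId A v‖ ^ 2 = 2 * ⟪-v, subId A v⟫ := by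
  have h := A.norm_map v
  have h1 : ⟪A v, A v⟫ = ⟪v, v⟫ := by rw [A.inner_map_map]
  rw [← real_inner_self_eq_norm_sq]
  simp only [subId_apply, inner_sub_left, inner_sub_right, inner_neg_left, h1,
    real_inner_comm v (A v)]
  ring

variable [FiniteDimensional ℝ E]

theorem det_adjoint_eq (f : E →ₗ[ℝ] E) :
    LinearMap.det (LinearMap.adjoint f) = LinearMap.det f := by
  rw [← LinearMap.det_toMatrix (stdOrthonormalBasis ℝ E).toBasis, LinearMap.toMatrix_adjoint,
    Matrix.det_conjTranspose, LinearMap.det_toMatrix, star_trivial]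

/-- For a rotation `A` the rank of `A - 1` is even. Let `P` be the projection onto the fixed space
`K` of `A`, `R = 2P - 1` the reflection in `K`, and `M = A - 1 + P`, which is invertible. Then
`R Mᵀ = Aᵀ M`, so `det R = 1`, while `det R = (-1) ^ dim Kᗮ`. -/
theorem even_finrank_range_subId (A : E ≃ₗᵢ[ℝ] E)
    (hA : LinearMap.det (A.toLinearEquiv : E →ₗ[ℝ] E) = 1) :
    Even (finrank ℝ (LinearMap.range (subId A))) := by
  set K := LinearMap.ker (subId A) with hK
  set P : E →ₗ[ℝ] E := K.starProjection.toLinearMap with hP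
  set a : E →ₗ[ℝ] E := (A.toLinearEquiv : E →ₗ[ℝ] E) with ha
  have haP : ∀ v, A (P v) = P v := fun v => by
    have : P v ∈ K := K.starProjection_apply_mem v
    exact sub_eq_zero.1 (LinearMap.mem_ker.1 this)
  have hPsymm : ∀ v w, ⟪P v, w⟫ = ⟪v, P w⟫ := fun v w =>
    K.inner_starProjection_left_eq_right v w
  set M : E →ₗ[ℝ] E := a - LinearMap.id + P with hM
  have hMv : ∀ v, M v = A v - v + P v := fun v => rfl
  have hinj : LinearMap.ker M = ⊥ := by
    rw [LinearMap.ker_eq_bot']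
    intro v hv
    have hPv : P v = 0 := by
      have h1 : ⟪P v, subId A v⟫ = 0 :=
        inner_subId_of_fixed A (LinearMap.mem_ker.1 (K.starProjection_apply_mem v)) v
      have h2 : subId A v = - P v := by
        rw [hMv] at hv; rw [subId_apply]; exact eq_neg_of_add_eq_zero_left hv
      rw [h2, inner_neg_right, neg_eq_zero] at h1
      exact inner_self_eq_zero.1 h1
    have hvK : v ∈ K := by
      rw [hK, LinearMap.mem_ker, subId_apply]
      rw [hMv, hPv, add_zero] at hv; exact hv
    have : P v = v := K.starProjection_eq_self_iff.2 hvK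
    rw [← this, hPv]
  have hdetM : LinearMap.det M ≠ 0 := by
    rw [← isUnit_iff_ne_zero]
    exact LinearMap.isUnit_det M ((LinearMap.isUnit_iff_ker_eq_bot M).2 hinj)
  have hR : ∀ v, K.reflection.toLinearMap v = 2 • P v - v := fun v => by
    simp [Submodule.reflection_apply, hP]
  have key : K.reflection.toLinearMap ∘ₗ LinearMap.adjoint M = LinearMap.adjoint a ∘ₗ M := by
    ext v
    refine ext_inner_right ℝ fun w => ?_
    have hRs : ∀ x, ⟪K.reflection.toLinearMap x, w⟫ = ⟪x, K.reflection.toLinearMap w⟫ := by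
      intro x
      rw [hR, hR]
      simp [inner_sub_left, inner_sub_right, two_smul, inner_add_left, inner_add_right, hPsymm]
    rw [LinearMap.comp_apply, hRs, LinearMap.adjoint_inner_left, LinearMap.comp_apply,
      LinearMap.adjoint_inner_left, hR, hMv, hMv]
    have h1 : P (P w) = P w := K.starProjection_eq_self_iff.2 (K.starProjection_apply_mem w)
    have h3 : ⟪P v, A w⟫ = ⟪P v, w⟫ := by
      rw [← haP v, A.inner_map_map, haP]
    have h4 : ⟪A v, A w⟫ = ⟪v, w⟫ := A.inner_map_map v w
    have h5 : a w = A w := rfl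
    rw [h5, two_smul]
    simp only [map_sub, map_add, haP, h1, inner_add_left, inner_sub_left, inner_sub_right,
      inner_add_right, h4, h3]
    rw [hPsymm]
    ring
  have hdet := congrArg LinearMap.det key
  rw [LinearMap.det_comp, LinearMap.det_comp, det_adjoint_eq, det_adjoint_eq, hA,
    Submodule.det_reflection] at hdet
  have h1 : (-1 : ℝ) ^ finrank ℝ Kᗮ = 1 := mul_right_cancel₀ hdetM (by rw [hdet, one_mul])
  have h2 : Even (finrank ℝ Kᗮ) := by
    by_contra hodd
    rw [(Nat.not_even_iff_odd.1 hodd).neg_one_pow] at h1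
    norm_num at h1
  have h3 := K.finrank_add_finrank_orthogonal
  have h4 := (subId A).finrank_range_add_finrank_ker
  rw [← hK] at h4
  rwa [show finrank ℝ (LinearMap.range (subId A)) = finrank ℝ Kᗮ by omega]

/-- A rotation `A` with `A - 1` of rank at most one is the identity. -/
theorem subId_eq_zero_of_range_le (A : E ≃ₗᵢ[ℝ] E)
    (hA : LinearMap.det (A.toLinearEquiv : E →ₗ[ℝ] E) = 1) {e : E}
    (h : ∀ v, ∃ r : ℝ, subId A v = r • e) : subId A = 0 := by
  have hle : LinearMap.range (subId A) ≤ Submodule.span ℝ {e} := by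
    rintro _ ⟨v, rfl⟩
    obtain ⟨r, hr⟩ := h v
    exact Submodule.mem_span_singleton.2 ⟨r, hr.symm⟩
  have h1 := (Submodule.finrank_mono hle).trans (finrank_span_le_card ({e} : Set E))
  simp only [Set.toFinset_singleton, Finset.card_singleton] at h1
  have h2 := even_finrank_range_subId A hA
  have h3 : finrank ℝ (LinearMap.range (subId A)) = 0 := by
    rcases Nat.le_one_iff_eq_zero_or_eq_one.1 h1 with h | h
    · exact h
    · rw [h] at h2; exact absurd h2 (by decide)
  exact LinearMap.range_eq_bot.1 (Submodule.finrank_eq_zero.1 h3)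

end Rotation

/-! ### Motions with circular trajectories -/

section Family

variable {E : Type*} [NormedAddCommGroup E] [InnerProductSpace ℝ E]

/-- A motion with linear parts `A t` that starts with the identity at time `t₀`, described by the
displacement `u t q` of the point `q` at time `t`. Circularity of the trajectories is recorded by
two conditions which survive the passage to the linear parts: any three displacements of a point
are linearly dependent, and the trajectory of `q` lies on a sphere through `q`, whose center is
`q + y`. A trajectory that is at rest is not excluded. -/
structure IsCircularFamily (A : ℝ → E ≃ₗᵢ[ℝ] E) (u : ℝ → E → E) (I : Set ℝ) (t₀ : ℝ) :
    Prop where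
  ordConnected : I.OrdConnected
  base_mem : t₀ ∈ I
  base : ∀ q, u t₀ q = 0
  map_add : ∀ t q w, u t (q + w) = u t q + subId (A t) w
  continuousOn : ∀ q, ContinuousOn (fun t => u t q) I
  planar : ∀ q, ∀ r ∈ I, ∀ s ∈ I, ∀ t ∈ I, ¬ LinearIndependent ℝ ![u r q, u s q, u t q]
  cospherical : ∀ q, ∃ y, ∀ t ∈ I, ‖u t q‖ ^ 2 = 2 * ⟪y, u t q⟫

namespace IsCircularFamily

variable {A : ℝ → E ≃ₗᵢ[ℝ] E} {u : ℝ → E → E} {I : Set ℝ} {t₀ : ℝ}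

theorem subId_eq (h : IsCircularFamily A u I t₀) (t : ℝ) (v : E) :
    subId (A t) v = u t v - u t 0 := by
  have := h.map_add t 0 v
  rw [zero_add] at this
  rw [this, add_sub_cancel_left]

theorem subId_base (h : IsCircularFamily A u I t₀) (v : E) : subId (A t₀) v = 0 := by
  rw [h.subId_eq, h.base, h.base, sub_zero]

theorem continuousOn_subId (h : IsCircularFamily A u I t₀) (v : E) :
    ContinuousOn (fun t => subId (A t) v) I := by
  simp only [h.subId_eq]
  exact (h.continuousOn v).sub (h.continuousOn 0)

/-- The linear parts of a circular family form a circular family again: the displacement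
`A t v - v` is the limit of `ε • u t (ε⁻¹ • v)` for `ε → 0`. -/
theorem linear (h : IsCircularFamily A u I t₀) :
    IsCircularFamily A (fun t v => subId (A t) v) I t₀ where
  ordConnected := h.ordConnected
  base_mem := h.base_mem
  base := h.subId_base
  map_add t q w := _root_.map_add _ q w
  continuousOn := h.continuousOn_subId
  cospherical q := ⟨-q, fun t _ => two_mul_inner_subId (A t) q⟩
  planar q r hr s hs t ht := by
    have hc : ∀ t, Continuous fun ε : ℝ => subId (A t) q + ε • u t 0 := fun t => by fun_prop
    have key := not_linearIndependent_triple_of_continuous (hc r) (hc s) (hc t) ?_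
    · simpa using key
    intro ε hε hli
    apply h.planar (ε⁻¹ • q) r hr s hs t ht
    have e : ∀ t, subId (A t) q + ε • u t 0 = ε • u t (ε⁻¹ • q) := by
      intro t
      have := h.map_add t 0 (ε⁻¹ • q)
      rw [zero_add] at this
      rw [this, map_smul, smul_add, smul_smul, mul_inv_cancel₀ hε, one_smul, add_comm]
    refine LinearIndependent.of_comp (LinearMap.lsmul ℝ E ε) ?_
    convert hli using 1
    ext i
    fin_cases i <;> exact (e _).symm

/-- A point that is not at rest has two linearly independent displacements: the points of a line
on a sphere are at most two, and an interval cannot be mapped continuously onto two points. -/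
theorem exists_linearIndependent (h : IsCircularFamily A u I t₀) {q : E} {t : ℝ} (ht : t ∈ I)
    (hq : u t q ≠ 0) : ∃ s ∈ I, LinearIndependent ℝ ![u t q, u s q] := by
  by_contra! hdep
  obtain ⟨y, hy⟩ := h.cospherical q
  have hval : ∀ s ∈ I, ‖u s q‖ ∈ ({0, ‖u t q‖} : Set ℝ) := by
    intro s hs
    have h1 := hdep s hs
    rw [LinearIndependent.pair_iff' hq] at h1
    push Not at h1
    obtain ⟨a, ha⟩ := h1
    have h2 := hy s hs
    have h3 := hy t ht
    rw [← ha, norm_smul, mul_pow, inner_smul_right, Real.norm_eq_abs, sq_abs] at h2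
    have h4 : ‖u t q‖ ^ 2 ≠ 0 := by positivity
    have h5 : a * (a - 1) * ‖u t q‖ ^ 2 = 0 := by linear_combination h2 - a * h3
    have h6 : a = 0 ∨ a = 1 := by
      rcases mul_eq_zero.1 h5 with h5 | h5
      · rcases mul_eq_zero.1 h5 with h5 | h5
        · exact .inl h5
        · exact .inr (by linarith)
      · exact absurd h5 h4
    rcases h6 with rfl | rfl <;> simp [← ha]
  have := (h.continuousOn q).norm.eq_of_finite_image h.ordConnected (Set.toFinite _) hval
    h.base_mem ht
  rw [h.base, norm_zero] at this
  exact hq (norm_eq_zero.1 this.symm)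

/-- If at time `s` a point `p` which is not always at rest has returned to its initial position,
then `A s - 1` maps into the tangent of the trajectory of `p`. Indeed `A s - 1` maps `w` to the
limit of the displacements of `p + ε • w` divided by `ε`, so it maps into the plane of the circle;
considering with each displacement `z` also `‖z‖ ^ 2`, one sees that the image is orthogonal to the
radius. -/
theorem exists_subId_eq_smul (h : IsCircularFamily A u I t₀) {p : E} {s t : ℝ} (hs : s ∈ I)
    (ht : t ∈ I) (hsp : u s p = 0) (htp : u t p ≠ 0) :
    ∃ e, ∀ v, ∃ r : ℝ, subId (A s) v = r • e := by
  obtain ⟨t', ht', hli⟩ := h.exists_linearIndependent ht htp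
  refine ⟨‖u t' p‖ ^ 2 • u t p - ‖u t p‖ ^ 2 • u t' p, fun w => ?_⟩
  have hexp : ∀ τ (ε : ℝ), u τ (p + ε • w) = u τ p + ε • subId (A τ) w := fun τ ε => by
    rw [h.map_add, map_smul]
  have hcont : ∀ τ, Continuous fun ε : ℝ =>
      ((u τ (p + ε • w), ‖u τ (p + ε • w)‖ ^ 2) : E × ℝ) := fun τ => by
    simp only [hexp]
    fun_prop
  have hcont' : Continuous fun ε : ℝ => ((subId (A s) w, ε * ‖subId (A s) w‖ ^ 2) : E × ℝ) := by
    fun_prop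
  have key := exists_eq_smul_add_smul_of_continuous hcont' (hcont t) (hcont t') ?_ ?_
  · obtain ⟨a, b, hab⟩ := key
    simp only [zero_smul, add_zero, zero_mul, Prod.smul_mk, Prod.mk_add_mk, Prod.mk.injEq,
      smul_eq_mul] at hab
    obtain ⟨h1, h2⟩ := hab
    have h3 : ‖u t p‖ ^ 2 ≠ 0 := by positivity
    refine ⟨-b / ‖u t p‖ ^ 2, ?_⟩
    have h4 : a = -b / ‖u t p‖ ^ 2 * ‖u t' p‖ ^ 2 := by
      field_simp
      linarith
    have h5 : -b / ‖u t p‖ ^ 2 * ‖u t p‖ ^ 2 = -b := div_mul_cancel₀ _ h3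
    rw [h1, smul_sub, smul_smul, smul_smul, ← h4, h5, neg_smul, sub_neg_eq_add]
  · intro ε hε hli
    obtain ⟨y, hy⟩ := h.cospherical (p + ε • w)
    let f : E →ₗ[ℝ] E × ℝ := LinearMap.prod LinearMap.id ((2 : ℝ) • (innerₗ E y))
    refine not_linearIndependent_triple_of_smul hε ?_ (LinearIndependent.of_comp f ?_)
      (x := subId (A s) w) (y := u t (p + ε • w)) (z := u t' (p + ε • w))
    · have := h.planar (p + ε • w) s hs t ht t' ht'
      rwa [hexp s, hsp, zero_add] at this
    · have h1 := hy s hs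
      rw [hexp, hsp, zero_add, norm_smul, mul_pow, inner_smul_right, Real.norm_eq_abs,
        sq_abs] at h1
      have h2 : 2 * ⟪y, subId (A s) w⟫ = ε * ‖subId (A s) w‖ ^ 2 :=
        mul_left_cancel₀ hε (by linear_combination -h1)
      have h3 : f ∘ ![subId (A s) w, u t (p + ε • w), u t' (p + ε • w)] =
          ![(subId (A s) w, ε * ‖subId (A s) w‖ ^ 2),
            (u t (p + ε • w), ‖u t (p + ε • w)‖ ^ 2),
            (u t' (p + ε • w), ‖u t' (p + ε • w)‖ ^ 2)] := by
        ext i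
        · fin_cases i <;> rfl
        · fin_cases i
          · exact h2
          · exact (hy t ht).symm
          · exact (hy t' ht').symm
      rwa [h3]
  · refine LinearIndependent.of_comp (LinearMap.fst ℝ E ℝ) ?_
    convert hli using 1
    ext i
    fin_cases i <;> simp

variable [FiniteDimensional ℝ E]

/-- A point that is not always at rest can return to its initial position only when the
orientation does. -/
theorem subId_eq_zero (h : IsCircularFamily A u I t₀)
    (hdet : ∀ t ∈ I, LinearMap.det ((A t).toLinearEquiv : E →ₗ[ℝ] E) = 1) {p : E} {s t : ℝ}
    (hs : s ∈ I) (ht : t ∈ I) (hsp : u s p = 0) (htp : u t p ≠ 0) : subId (A s) = 0 := by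
  obtain ⟨e, he⟩ := h.exists_subId_eq_smul hs ht hsp htp
  exact subId_eq_zero_of_range_le (A s) (hdet s hs) he

end IsCircularFamily

end Family

/-! ### The fixed direction plane of the rotations -/

section Conformal

variable {E : Type*} [NormedAddCommGroup E] [InnerProductSpace ℝ E]

/-- `e₁, e₂` is an orthonormal basis of the plane `Kᗮ`. -/
structure IsOrthonormalPair (K : Submodule ℝ E) (e₁ e₂ : E) : Prop where
  inner_left : ⟪e₁, e₁⟫ = 1
  inner_right : ⟪e₂, e₂⟫ = 1
  inner_left_right : ⟪e₁, e₂⟫ = 0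
  left_mem : e₁ ∈ Kᗮ
  right_mem : e₂ ∈ Kᗮ
  exists_eq : ∀ w ∈ Kᗮ, ∃ a b : ℝ, w = a • e₁ + b • e₂

theorem exists_isOrthonormalPair [FiniteDimensional ℝ E] {K : Submodule ℝ E}
    (hK : finrank ℝ Kᗮ = 2) : ∃ e₁ e₂, IsOrthonormalPair K e₁ e₂ := by
  let b := (stdOrthonormalBasis ℝ Kᗮ).reindex (finCongr hK)
  have hb := orthonormal_iff_ite.1 b.orthonormal
  refine ⟨b 0, b 1, ?_, ?_, ?_, (b 0).2, (b 1).2, fun w hw => ?_⟩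
  · exact (hb 0 0).trans (if_pos rfl)
  · exact (hb 1 1).trans (if_pos rfl)
  · exact (hb 0 1).trans (if_neg (by decide))
  · have := congrArg Subtype.val (b.sum_repr ⟨w, hw⟩)
    rw [Fin.sum_univ_two] at this
    exact ⟨_, _, this.symm⟩

/-- In the plane with basis `e₁, e₂` the map `Z` is multiplication by a complex number. These maps
form a linear space, and they vanish as soon as they are singular. -/
def IsComplexOn (e₁ e₂ : E) (Z : E →ₗ[ℝ] E) : Prop :=
  ∃ a b : ℝ, Z e₁ = a • e₁ + b • e₂ ∧ Z e₂ = -b • e₁ + a • e₂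

variable {K : Submodule ℝ E} {e₁ e₂ : E} {Z Z' : E →ₗ[ℝ] E}

theorem IsComplexOn.sub (h : IsComplexOn e₁ e₂ Z) (h' : IsComplexOn e₁ e₂ Z') :
    IsComplexOn e₁ e₂ (Z - Z') := by
  obtain ⟨a, b, h1, h2⟩ := h
  obtain ⟨a', b', h1', h2'⟩ := h'
  refine ⟨a - a', b - b', ?_, ?_⟩
  · rw [LinearMap.sub_apply, h1, h1']; module
  · rw [LinearMap.sub_apply, h2, h2']; module

theorem IsComplexOn.smul (h : IsComplexOn e₁ e₂ Z) (r : ℝ) : IsComplexOn e₁ e₂ (r • Z) := by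
  obtain ⟨a, b, h1, h2⟩ := h
  refine ⟨r * a, r * b, ?_, ?_⟩
  · rw [LinearMap.smul_apply, h1]; module
  · rw [LinearMap.smul_apply, h2]; module

namespace IsOrthonormalPair

theorem eq_zero_and_eq_zero (he : IsOrthonormalPair K e₁ e₂) {a b : ℝ} (h : a • e₁ + b • e₂ = 0) :
    a = 0 ∧ b = 0 := by
  have h1 : ⟪e₁, a • e₁ + b • e₂⟫ = 0 := by rw [h, inner_zero_right]
  have h2 : ⟪e₂, a • e₁ + b • e₂⟫ = 0 := by rw [h, inner_zero_right]
  simp only [inner_add_right, inner_smul_right, he.inner_left, he.inner_left_right,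
    he.inner_right, real_inner_comm e₁ e₂] at h1 h2
  constructor <;> linarith

theorem inner_eq (he : IsOrthonormalPair K e₁ e₂) (a b c d : ℝ) :
    ⟪a • e₁ + b • e₂, c • e₁ + d • e₂⟫ = a * c + b * d := by
  simp only [inner_add_left, inner_add_right, inner_smul_right, real_inner_smul_left,
    he.inner_left, he.inner_left_right, he.inner_right, real_inner_comm e₁ e₂]
  ring

theorem eq_zero_of_inner_eq_zero (he : IsOrthonormalPair K e₁ e₂) (hZ : IsComplexOn e₁ e₂ Z)
    {w : E} (hw : w ∈ Kᗮ) (hw0 : w ≠ 0) (h₁ : ⟪w, Z e₁⟫ = 0) (h₂ : ⟪w, Z e₂⟫ = 0) :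
    Z e₁ = 0 ∧ Z e₂ = 0 := by
  obtain ⟨a, b, h1, h2⟩ := hZ
  obtain ⟨c, d, rfl⟩ := he.exists_eq w hw
  rw [h1, he.inner_eq] at h₁
  rw [h2, he.inner_eq] at h₂
  have h3 : (c ^ 2 + d ^ 2) * a = 0 := by linear_combination c * h₁ + d * h₂
  have h4 : (c ^ 2 + d ^ 2) * b = 0 := by linear_combination d * h₁ - c * h₂
  have h5 : c ^ 2 + d ^ 2 ≠ 0 := by
    intro h5
    have hc : c = 0 := by nlinarith
    have hd : d = 0 := by nlinarith
    simp [hc, hd] at hw0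
  have ha := (mul_eq_zero.1 h3).resolve_left h5
  have hb := (mul_eq_zero.1 h4).resolve_left h5
  rw [h1, h2, ha, hb]
  simp

theorem eq_zero_of_mem_line (he : IsOrthonormalPair K e₁ e₂) (hZ : IsComplexOn e₁ e₂ Z)
    {w : E} {r s : ℝ} (h₁ : Z e₁ = r • w) (h₂ : Z e₂ = s • w) : Z e₁ = 0 ∧ Z e₂ = 0 := by
  obtain ⟨a, b, h1, h2⟩ := hZ
  have h3 : (s * a + r * b) • e₁ + (s * b - r * a) • e₂ = 0 := by
    have : s • Z e₁ - r • Z e₂ = 0 := by rw [h₁, h₂]; module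
    rw [← this, h1, h2]; module
  obtain ⟨h4, h5⟩ := he.eq_zero_and_eq_zero h3
  have h6 : s * (a ^ 2 + b ^ 2) = 0 := by linear_combination a * h4 + b * h5
  have h7 : r * (a ^ 2 + b ^ 2) = 0 := by linear_combination b * h4 - a * h5
  by_cases h8 : a ^ 2 + b ^ 2 = 0
  · have ha : a = 0 := by nlinarith
    have hb : b = 0 := by nlinarith
    rw [h1, h2, ha, hb]; simp
  · rw [h₁, h₂, (mul_eq_zero.1 h6).resolve_right h8, (mul_eq_zero.1 h7).resolve_right h8]
    simp

variable [FiniteDimensional ℝ E]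

theorem exists_decomposition (he : IsOrthonormalPair K e₁ e₂) (v : E) :
    ∃ a b : ℝ, ∃ k ∈ K, v = a • e₁ + b • e₂ + k := by
  obtain ⟨k, hk, w, hw, rfl⟩ := K.exists_add_mem_mem_orthogonal v
  obtain ⟨a, b, rfl⟩ := he.exists_eq w hw
  exact ⟨a, b, k, hk, add_comm _ _⟩

theorem linearMap_ext (he : IsOrthonormalPair K e₁ e₂) (h₁ : Z e₁ = Z' e₁) (h₂ : Z e₂ = Z' e₂)
    (hK : ∀ k ∈ K, Z k = Z' k) : Z = Z' := by
  ext v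
  obtain ⟨a, b, k, hk, rfl⟩ := he.exists_decomposition v
  simp only [map_add, map_smul, h₁, h₂, hK k hk]

/-- A rotation that fixes `K` pointwise acts on the plane `Kᗮ` as a complex number: otherwise it
would act there as a reflection in a line, and `A - 1` would have rank one. -/
theorem isComplexOn_subId (he : IsOrthonormalPair K e₁ e₂) (A : E ≃ₗᵢ[ℝ] E)
    (hA : LinearMap.det (A.toLinearEquiv : E →ₗ[ℝ] E) = 1) (hK : ∀ k ∈ K, subId A k = 0) :
    IsComplexOn e₁ e₂ (subId A) := by
  have hmem : ∀ v, subId A v ∈ Kᗮ := fun v k hk => inner_subId_of_fixed A (hK k hk) v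
  obtain ⟨a, b, h1⟩ := he.exists_eq _ (hmem e₁)
  obtain ⟨c, d, h2⟩ := he.exists_eq _ (hmem e₂)
  have g1 : A e₁ = (1 + a) • e₁ + b • e₂ := by
    rw [subId_apply, sub_eq_iff_eq_add] at h1; rw [h1]; module
  have g2 : A e₂ = c • e₁ + (1 + d) • e₂ := by
    rw [subId_apply, sub_eq_iff_eq_add] at h2; rw [h2]; module
  have i1 : (1 + a) * (1 + a) + b * b = 1 := by
    rw [← he.inner_eq, ← g1, A.inner_map_map, he.inner_left]
  have i2 : c * c + (1 + d) * (1 + d) = 1 := by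
    rw [← he.inner_eq, ← g2, A.inner_map_map, he.inner_right]
  have i3 : (1 + a) * c + b * (1 + d) = 0 := by
    rw [← he.inner_eq, ← g1, ← g2, A.inner_map_map, he.inner_left_right]
  have hdet : ((1 + a) * (1 + d) - b * c) ^ 2 = 1 := by
    linear_combination (c * c + (1 + d) * (1 + d)) * i1 + i2 -
      ((1 + a) * c + b * (1 + d)) * i3
  rcases sq_eq_sq_iff_eq_or_eq_neg.1 (hdet.trans (one_pow 2).symm) with h | h
  · have h3 : (c + b) ^ 2 + (d - a) ^ 2 = 0 := by linear_combination i1 + i2 - 2 * h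
    have hc : c = -b := by nlinarith
    have hd : d = a := by nlinarith
    exact ⟨a, b, h1, by rw [h2, hc, hd]⟩
  · have h3 : (c - b) ^ 2 + (2 + a + d) ^ 2 = 0 := by linear_combination i1 + i2 + 2 * h
    have hc : c = b := by nlinarith
    have hd : d = -(2 + a) := by nlinarith
    have hline : ∃ e, ∀ v, ∃ r : ℝ, subId A v = r • e := by
      suffices ∃ e, ∃ r s : ℝ, subId A e₁ = r • e ∧ subId A e₂ = s • e by
        obtain ⟨e, r, s, hr, hs⟩ := this
        refine ⟨e, fun v => ?_⟩
        obtain ⟨x, y, k, hk, rfl⟩ := he.exists_decomposition v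
        refine ⟨x * r + y * s, ?_⟩
        rw [map_add, map_add, map_smul, map_smul, hr, hs, hK k hk]
        module
      by_cases ha : a = 0
      · have hb : b = 0 := by rw [ha] at i1; nlinarith
        refine ⟨e₂, 0, d, ?_, ?_⟩
        · rw [h1, ha, hb]; simp
        · rw [h2, hc, hb]; simp
      · refine ⟨a • e₁ + b • e₂, 1, b / a, by rw [h1, one_smul], ?_⟩
        have h4 : d = b / a * b := by
          field_simp
          rw [hd]
          linear_combination -i1
        have h5 : c = b / a * a := by rw [hc, div_mul_cancel₀ _ ha]
        rw [h2, smul_add, smul_smul, smul_smul, ← h4, ← h5]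
    obtain ⟨e, hline⟩ := hline
    have := subId_eq_zero_of_range_le A hA hline
    exact ⟨0, 0, by simp [this], by simp [this]⟩

end IsOrthonormalPair

end Conformal

/-! ### Rotation angles and centers -/

namespace IsCircularFamily

variable {E : Type*} [NormedAddCommGroup E] [InnerProductSpace ℝ E]
  {A : ℝ → E ≃ₗᵢ[ℝ] E} {u : ℝ → E → E} {I : Set ℝ} {t₀ : ℝ}

/-- If the displacements of `c` at times `s` and `t` are independent, then at every other time `τ`
the displacement of `c` is a combination of them, and the same combination of the linear
parts deviates from `A τ - 1` by a map into the plane of the trajectory of `c`. -/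
theorem exists_combination (h : IsCircularFamily A u I t₀) {c : E} {s t τ : ℝ} (hs : s ∈ I)
    (ht : t ∈ I) (hτ : τ ∈ I) (hli : LinearIndependent ℝ ![u s c, u t c]) :
    ∃ f g : ℝ, u τ c = f • u s c + g • u t c ∧
      ∀ w, ∃ a b : ℝ, (subId (A τ) - f • subId (A s) - g • subId (A t)) w =
        a • u s c + b • u t c := by
  have h1 : u τ c ∈ Submodule.span ℝ {u s c, u t c} := by
    have := h.planar c τ hτ s hs t ht
    rw [linearIndependent_triple_iff] at this
    tauto
  obtain ⟨f, g, hfg⟩ := Submodule.mem_span_pair.1 h1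
  refine ⟨f, g, hfg.symm, fun w => ?_⟩
  set Z := subId (A τ) - f • subId (A s) - g • subId (A t) with hZ
  have hexp : ∀ τ (ε : ℝ), u τ (c + ε • w) = u τ c + ε • subId (A τ) w := fun τ ε => by
    rw [h.map_add, map_smul]
  have hcont : ∀ τ, Continuous fun ε : ℝ => u τ (c + ε • w) := fun τ => by
    simp only [hexp]
    fun_prop
  have key := exists_eq_smul_add_smul_of_continuous (continuous_const (y := Z w)) (hcont s)
    (hcont t) ?_ (by simpa using hli)
  · simpa using key
  intro ε hε
  refine not_linearIndependent_triple_of_smul hε ?_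
  have := h.planar (c + ε • w) τ hτ s hs t ht
  rw [linearIndependent_triple_iff] at this ⊢
  have h2 : ε • Z w = u τ (c + ε • w) - (f • u s (c + ε • w) + g • u t (c + ε • w)) := by
    rw [hexp, hexp, hexp, ← hfg, hZ]
    simp only [LinearMap.sub_apply, LinearMap.smul_apply]
    module
  have h3 : f • u s (c + ε • w) + g • u t (c + ε • w) ∈
      Submodule.span ℝ {u s (c + ε • w), u t (c + ε • w)} :=
    Submodule.mem_span_pair.2 ⟨f, g, rfl⟩
  rwa [h2, Submodule.sub_mem_iff_left _ h3]

variable [FiniteDimensional ℝ E]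

/-- In dimension four, if no point stays at rest and `A s ≠ 1`, then `A s` is a rotation about a
plane of directions `ker (A s - 1)`. If `A s - 1` were invertible, then the displacement of some
point would vanish at time `s`. -/
theorem finrank_ker_subId (h : IsCircularFamily A u I t₀)
    (hdet : ∀ t ∈ I, LinearMap.det ((A t).toLinearEquiv : E →ₗ[ℝ] E) = 1)
    (hdim : finrank ℝ E = 4) (hmove : ∀ q, ∃ t ∈ I, u t q ≠ 0) {s : ℝ} (hs : s ∈ I)
    (hne : subId (A s) ≠ 0) : finrank ℝ (LinearMap.ker (subId (A s))) = 2 := by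
  have heven := even_finrank_range_subId (A s) (hdet s hs)
  have hsum := (subId (A s)).finrank_range_add_finrank_ker
  have hr0 : finrank ℝ (LinearMap.range (subId (A s))) ≠ 0 := fun h0 =>
    hne (LinearMap.range_eq_bot.1 (Submodule.finrank_eq_zero.1 h0))
  have hr4 : finrank ℝ (LinearMap.range (subId (A s))) ≠ 4 := by
    intro h4
    have htop : LinearMap.range (subId (A s)) = ⊤ :=
      Submodule.eq_top_of_finrank_eq (h4.trans hdim.symm)
    obtain ⟨p, hp⟩ := LinearMap.range_eq_top.1 htop (-u s 0)
    have hsp : u s p = 0 := by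
      have := h.map_add s 0 p
      rw [zero_add] at this
      rw [this, hp, add_neg_cancel]
    obtain ⟨t, ht, htp⟩ := hmove p
    exact hne (h.subId_eq_zero hdet hs ht hsp htp)
  obtain ⟨m, hm⟩ := heven
  omega

/-- The directions fixed by a nontrivial `A s` are fixed by all `A t`, because a direction that
moves can return only when the whole orientation does. -/
theorem subId_apply_eq_zero (h : IsCircularFamily A u I t₀)
    (hdet : ∀ t ∈ I, LinearMap.det ((A t).toLinearEquiv : E →ₗ[ℝ] E) = 1)
    {s t : ℝ} (hs : s ∈ I) (hne : subId (A s) ≠ 0) (ht : t ∈ I) {k : E}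
    (hk : subId (A s) k = 0) : subId (A t) k = 0 := by
  by_contra hkt
  exact hne (h.linear.subId_eq_zero hdet hs ht hk hkt)

/-- All `A t` fix the plane `K` pointwise, and the displacement of `c` at time `s` is a nonzero
vector of `K`. Then all displacements of `c` lie in `K`. Suppose that at time `t` this fails. The
displacements at all times `τ` are then combinations, with coefficients independent of the point,
of those at times `s` and `t`. Circularity of the trajectories of the points `c ± x` with
`x ∈ Kᗮ` forces `A τ` to be one of `1`, `A s`, `A t`, which contradicts continuity. -/
theorem displacement_mem (h : IsCircularFamily A u I t₀)
    (hdet : ∀ t ∈ I, LinearMap.det ((A t).toLinearEquiv : E →ₗ[ℝ] E) = 1)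
    {K : Submodule ℝ E} (hKdim : finrank ℝ Kᗮ = 2) (hK : ∀ t ∈ I, ∀ k ∈ K, subId (A t) k = 0)
    {c : E} {s : ℝ} (hs : s ∈ I) (hne : subId (A s) ≠ 0) (hsK : u s c ∈ K) (hs0 : u s c ≠ 0)
    {t : ℝ} (ht : t ∈ I) : u t c ∈ K := by
  by_contra htK
  obtain ⟨e₁, e₂, he⟩ := exists_isOrthonormalPair hKdim
  have hcx : ∀ τ ∈ I, IsComplexOn e₁ e₂ (subId (A τ)) := fun τ hτ =>
    he.isComplexOn_subId (A τ) (hdet τ hτ) (hK τ hτ)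
  have hmem : ∀ τ ∈ I, ∀ v, subId (A τ) v ∈ Kᗮ := fun τ hτ v k hk =>
    inner_subId_of_fixed (A τ) (hK τ hτ k hk) v
  obtain ⟨k, hk, w, hw, hkw⟩ := K.exists_add_mem_mem_orthogonal (u t c)
  have hw0 : w ≠ 0 := by
    rintro rfl
    rw [add_zero] at hkw
    exact htK (hkw ▸ hk)
  have hli : LinearIndependent ℝ ![u s c, u t c] := by
    rw [LinearIndependent.pair_iff' hs0]
    intro a ha
    exact htK (ha ▸ K.smul_mem a hsK)
  have hval : ∀ τ ∈ I, subId (A τ) = 0 ∨ subId (A τ) = subId (A s) ∨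
      subId (A τ) = subId (A t) := by
    intro τ hτ
    obtain ⟨f, g, hfg, hZ⟩ := h.exists_combination hs ht hτ hli
    have hZK : ∀ k ∈ K, (subId (A τ) - f • subId (A s) - g • subId (A t)) k = 0 := by
      intro k hk
      simp [hK τ hτ k hk, hK s hs k hk, hK t ht k hk]
    have hZline : ∀ v, ∃ b : ℝ,
        (subId (A τ) - f • subId (A s) - g • subId (A t)) v = b • w := by
      intro v
      obtain ⟨a, b, hab⟩ := hZ v
      refine ⟨b, ?_⟩
      set z := (subId (A τ) - f • subId (A s) - g • subId (A t)) v with hz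
      have hzW : z ∈ Kᗮ := by
        rw [hz]
        exact Kᗮ.sub_mem (Kᗮ.sub_mem (hmem τ hτ v) (Kᗮ.smul_mem f (hmem s hs v)))
          (Kᗮ.smul_mem g (hmem t ht v))
      have h1 : z - b • w ∈ Kᗮ := Kᗮ.sub_mem hzW (Kᗮ.smul_mem b hw)
      have h2 : z - b • w ∈ K := by
        have : z - b • w = a • u s c + b • k := by rw [hab, hkw]; module
        rw [this]
        exact K.add_mem (K.smul_mem a hsK) (K.smul_mem b hk)
      have h3 := K.inner_right_of_mem_orthogonal h2 h1
      exact sub_eq_zero.1 (inner_self_eq_zero.1 h3)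
    have hZ0 : subId (A τ) = f • subId (A s) + g • subId (A t) := by
      have hZc := ((hcx τ hτ).sub ((hcx s hs).smul f)).sub ((hcx t ht).smul g)
      obtain ⟨r₁, hr₁⟩ := hZline e₁
      obtain ⟨r₂, hr₂⟩ := hZline e₂
      obtain ⟨h1, h2⟩ := he.eq_zero_of_mem_line hZc hr₁ hr₂
      have : subId (A τ) - f • subId (A s) - g • subId (A t) = 0 :=
        he.linearMap_ext h1 h2 (fun k hk => hZK k hk)
      rw [sub_sub, sub_eq_zero] at this
      exact this
    have hcomb : ∀ x, u τ (c + x) = f • u s (c + x) + g • u t (c + x) := by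
      intro x
      rw [h.map_add, h.map_add, h.map_add, hfg, hZ0]
      simp only [LinearMap.add_apply, LinearMap.smul_apply]
      module
    -- all displacements of `c + x` lie on one circle through the origin
    have hquad : ∀ x, f * (f - 1) * ‖u s (c + x)‖ ^ 2 + g * (g - 1) * ‖u t (c + x)‖ ^ 2 +
        2 * (f * g) * ⟪u s (c + x), u t (c + x)⟫ = 0 := by
      intro x
      obtain ⟨y, hy⟩ := h.cospherical (c + x)
      have h1 := hy s hs
      have h2 := hy t ht
      have h3 := hy τ hτ
      rw [hcomb, inner_add_right, inner_smul_right, inner_smul_right, norm_add_sq_real,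
        norm_smul, norm_smul, mul_pow, mul_pow, Real.norm_eq_abs, Real.norm_eq_abs, sq_abs,
        sq_abs, real_inner_smul_left, inner_smul_right] at h3
      linear_combination h3 - f * h1 - g * h2
    by_cases hg : g = 0
    · have h1 := hquad 0
      rw [hg, add_zero] at h1
      have h2 : f * (f - 1) = 0 := by
        have h3 : ‖u s c‖ ^ 2 ≠ 0 := by positivity
        exact (mul_eq_zero.1 (by linear_combination h1 :
          f * (f - 1) * ‖u s c‖ ^ 2 = 0)).resolve_right h3
      rcases mul_eq_zero.1 h2 with h3 | h3
      · left; rw [hZ0, hg, h3]; simp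
      · right; left; rw [hZ0, hg, show f = 1 by linarith]; simp
    · right; right
      have horth : ∀ x, ⟪w, (subId (A τ) - subId (A t)) x⟫ = 0 := by
        intro x
        -- the part of `hquad` that is odd in `x`
        have h1 := hquad x
        have h2 := hquad (-x)
        simp only [h.map_add, map_neg, norm_add_sq_real, norm_neg, inner_add_left,
          inner_add_right, inner_neg_left, inner_neg_right] at h1 h2
        have o : ∀ τ ∈ I, ∀ k ∈ K, ⟪k, subId (A τ) x⟫ = 0 := fun τ hτ k hk =>
          hmem τ hτ x k hk
        have o1 := o s hs _ hsK
        have o2 := o t ht _ hsK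
        have o3 : ⟪u t c, subId (A s) x⟫ = ⟪w, subId (A s) x⟫ := by
          rw [hkw, inner_add_left, o s hs k hk, zero_add]
        have o4 : ⟪u t c, subId (A t) x⟫ = ⟪w, subId (A t) x⟫ := by
          rw [hkw, inner_add_left, o t ht k hk, zero_add]
        rw [real_inner_comm (u t c) (subId (A s) x)] at h1 h2
        rw [o1, o2, o3, o4] at h1 h2
        rw [LinearMap.sub_apply, hZ0, LinearMap.add_apply, LinearMap.smul_apply,
          LinearMap.smul_apply, inner_sub_right, inner_add_right, inner_smul_right,
          inner_smul_right]
        refine mul_left_cancel₀ hg ?_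
        linear_combination (h1 - h2) / 4
      obtain ⟨h1, h2⟩ := he.eq_zero_of_inner_eq_zero ((hcx τ hτ).sub (hcx t ht)) hw hw0
        (horth e₁) (horth e₂)
      refine he.linearMap_ext (sub_eq_zero.1 h1) (sub_eq_zero.1 h2) fun k hk => ?_
      rw [hK τ hτ k hk, hK t ht k hk]
  obtain ⟨v, hv⟩ : ∃ v, subId (A s) v ≠ 0 := by
    by_contra! hall
    exact hne (LinearMap.ext hall)
  have hconst := (h.continuousOn_subId v).norm.eq_of_finite_image h.ordConnected
    (Set.toFinite {0, ‖subId (A s) v‖, ‖subId (A t) v‖}) (fun τ hτ => by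
      rcases hval τ hτ with h1 | h1 | h1 <;> simp [h1]) h.base_mem hs
  rw [h.subId_base, norm_zero] at hconst
  exact hv (norm_eq_zero.1 hconst.symm)

/-- In dimension four, a circular family without points at rest and with nonconstant orientation
has a plane of directions `K` fixed by all linear parts, and a point `c` moving parallel
to `K`. -/
theorem exists_fixed_plane (h : IsCircularFamily A u I t₀)
    (hdet : ∀ t ∈ I, LinearMap.det ((A t).toLinearEquiv : E →ₗ[ℝ] E) = 1)
    (hdim : finrank ℝ E = 4) (hmove : ∀ q, ∃ t ∈ I, u t q ≠ 0) {s : ℝ} (hs : s ∈ I)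
    (hne : subId (A s) ≠ 0) :
    ∃ K : Submodule ℝ E, finrank ℝ K = 2 ∧ (∀ t ∈ I, ∀ k ∈ K, subId (A t) k = 0) ∧
      ∃ c, ∀ t ∈ I, u t c ∈ K := by
  set K := LinearMap.ker (subId (A s)) with hKdef
  have hK2 : finrank ℝ K = 2 := h.finrank_ker_subId hdet hdim hmove hs hne
  have hK : ∀ t ∈ I, ∀ k ∈ K, subId (A t) k = 0 := fun t ht k hk =>
    h.subId_apply_eq_zero hdet hs hne ht hk
  have hperp : finrank ℝ Kᗮ = 2 := by
    have := K.finrank_add_finrank_orthogonal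
    omega
  have hrange : LinearMap.range (subId (A s)) = Kᗮ := by
    refine Submodule.eq_of_le_of_finrank_eq ?_ ?_
    · rintro _ ⟨v, rfl⟩ k hk
      exact inner_subId_of_fixed (A s) hk v
    · have := (subId (A s)).finrank_range_add_finrank_ker
      rw [← hKdef] at this
      omega
  -- the center of the rotation at time `s`, in the projection along `K`
  obtain ⟨k, hk, w, hw, hkw⟩ := K.exists_add_mem_mem_orthogonal (u s 0)
  rw [← hrange] at hw
  obtain ⟨c', hc'⟩ := hw
  have hsc : u s (-c') = k := by
    have := h.map_add s 0 (-c')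
    rw [zero_add] at this
    rw [this, hkw, map_neg, hc']
    abel
  refine ⟨K, hK2, hK, -c', fun t ht => ?_⟩
  refine h.displacement_mem hdet hperp hK hs hne (hsc ▸ hk) (fun h0 => ?_) ht
  obtain ⟨t', ht', hmt⟩ := hmove (-c')
  exact hne (h.subId_eq_zero hdet hs ht' h0 hmt)

end IsCircularFamily

/-! ### The decomposition of the motion -/

theorem not_linearIndependent_triple_of_mem {F : Type*} [AddCommGroup F] [Module ℝ F]
    {D : Submodule ℝ F} (hD : finrank ℝ D = 2) {x y z : F} (hx : x ∈ D) (hy : y ∈ D)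
    (hz : z ∈ D) : ¬ LinearIndependent ℝ ![x, y, z] := by
  intro hli
  have : Module.Finite ℝ D := Module.finite_of_finrank_pos (by omega)
  have h : LinearIndependent ℝ (![⟨x, hx⟩, ⟨y, hy⟩, ⟨z, hz⟩] : Fin 3 → D) := by
    refine LinearIndependent.of_comp D.subtype ?_
    convert hli using 1
    ext i
    fin_cases i <;> rfl
  have := h.fintype_card_le_finrank
  rw [hD, Fintype.card_fin] at this
  omega

namespace Kinematics

variable {γ : ℝ → E4 ≃ᵃⁱ[ℝ] E4} {I : Set ℝ}

/-- The displacement from time `t₀` to time `t`. -/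
noncomputable def relative (γ : ℝ → E4 ≃ᵃⁱ[ℝ] E4) (t₀ t : ℝ) : E4 ≃ᵃⁱ[ℝ] E4 :=
  (γ t₀).symm.trans (γ t)

theorem relative_apply (t₀ t : ℝ) (q : E4) : relative γ t₀ t q = γ t ((γ t₀).symm q) := rfl

theorem relative_add (t₀ t : ℝ) (q w : E4) :
    relative γ t₀ t (q + w) = relative γ t₀ t q + (relative γ t₀ t).linearIsometryEquiv w := by
  have := (relative γ t₀ t).map_vadd q w
  rw [vadd_eq_add, vadd_eq_add] at this
  rw [add_comm q, this, add_comm]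

theorem linear_relative (t₀ t : ℝ) (v : E4) : (relative γ t₀ t).linearIsometryEquiv v =
    (γ t).linearIsometryEquiv ((γ t₀).linearIsometryEquiv.symm v) := rfl

theorem isDisplacement_relative {t₀ t : ℝ} (h₀ : IsDisplacement (γ t₀))
    (h : IsDisplacement (γ t)) : IsDisplacement (relative γ t₀ t) := by
  have h1 : ((relative γ t₀ t).linearIsometryEquiv.toLinearEquiv : E4 →ₗ[ℝ] E4) ∘ₗ
      ((γ t₀).linearIsometryEquiv.toLinearEquiv : E4 →ₗ[ℝ] E4) =
      ((γ t).linearIsometryEquiv.toLinearEquiv : E4 →ₗ[ℝ] E4) := by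
    refine LinearMap.ext fun v => ?_
    change (relative γ t₀ t).linearIsometryEquiv ((γ t₀).linearIsometryEquiv v) = _
    rw [linear_relative, LinearIsometryEquiv.symm_apply_apply]
    rfl
  have h2 := congrArg LinearMap.det h1
  rw [LinearMap.det_comp, show LinearMap.det _ = (1 : ℝ) from h₀,
    show LinearMap.det _ = (1 : ℝ) from h, mul_one] at h2
  exact h2

theorem isCircularFamily (hI : I.OrdConnected) (hγ : IsMotionOn γ I)
    (hcirc : HasCircularTrajectories γ I) {t₀ : ℝ} (ht₀ : t₀ ∈ I) :
    IsCircularFamily (fun t => (relative γ t₀ t).linearIsometryEquiv)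
      (fun t q => relative γ t₀ t q - q) I t₀ where
  ordConnected := hI
  base_mem := ht₀
  base q := by rw [relative_apply, AffineIsometryEquiv.apply_symm_apply, sub_self]
  map_add t q w := by
    rw [relative_add, subId_apply]
    abel
  continuousOn q := (hγ.continuousOn _).sub continuousOn_const
  planar q r hr s hs t ht := by
    obtain ⟨C, ⟨c, D, R, hD, -, rfl⟩, hC⟩ := hcirc ((γ t₀).symm q)
    have hmem : ∀ τ ∈ I, relative γ t₀ τ q - q ∈ D := by
      intro τ hτ
      have h1 := (hC ⟨τ, hτ, rfl⟩).1
      have h2 := (hC ⟨t₀, ht₀, rfl⟩).1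
      have h3 := D.sub_mem h1 h2
      rw [sub_sub_sub_cancel_right] at h3
      simpa only [relative_apply, AffineIsometryEquiv.apply_symm_apply] using h3
    exact not_linearIndependent_triple_of_mem hD (hmem r hr) (hmem s hs) (hmem t ht)
  cospherical q := by
    obtain ⟨C, ⟨c, D, R, -, -, rfl⟩, hC⟩ := hcirc ((γ t₀).symm q)
    refine ⟨c - q, fun t ht => ?_⟩
    have h1 : dist (relative γ t₀ t q) c = R := (hC ⟨t, ht, rfl⟩).2
    have h2 : dist (γ t₀ ((γ t₀).symm q)) c = R := (hC ⟨t₀, ht₀, rfl⟩).2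
    rw [AffineIsometryEquiv.apply_symm_apply, dist_comm, dist_eq_norm] at h2
    rw [dist_eq_norm, ← sub_sub_sub_cancel_right _ _ q] at h1
    have h3 := norm_sub_sq_real (relative γ t₀ t q - q) (c - q)
    rw [h1, h2, real_inner_comm] at h3
    linarith

end Kinematics

theorem theorem2 (I : Set ℝ) (hI : I.OrdConnected) (γ : ℝ → E4 ≃ᵃⁱ[ℝ] E4)
    (hγ : Kinematics.IsMotionOn γ I)
    (hcirc : Kinematics.HasCircularTrajectories γ I)
    (hsph : ¬ Kinematics.IsSpherical γ I)
    (htrans : ¬ Kinematics.IsPureTranslation γ I) :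
    ∃ (P : AffineSubspace ℝ E4) (ρ σ : ℝ → E4 ≃ᵃⁱ[ℝ] E4) (g : E4 ≃ᵃⁱ[ℝ] E4),
      Module.finrank ℝ P.direction = 2 ∧
      Kinematics.IsDisplacement g ∧
      Kinematics.IsRotationAbout ρ I P ∧
      Kinematics.IsCircularTranslationParallelTo σ I P ∧
      ∀ t ∈ I, ∀ p : E4, γ t p = σ t (ρ t (g p)) := by
  obtain ⟨t₀, ht₀, s, hs, hst⟩ : ∃ t₀ ∈ I, ∃ s ∈ I,
      (γ t₀).linearIsometryEquiv ≠ (γ s).linearIsometryEquiv := by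
    simpa [Kinematics.IsPureTranslation] using htrans
  have hfam := Kinematics.isCircularFamily hI hγ hcirc ht₀
  have hdet : ∀ t ∈ I, Kinematics.IsDisplacement (Kinematics.relative γ t₀ t) := fun t ht =>
    Kinematics.isDisplacement_relative (hγ.displacement t₀ ht₀) (hγ.displacement t ht)
  have hmove : ∀ q, ∃ t ∈ I, Kinematics.relative γ t₀ t q - q ≠ 0 := by
    intro q
    by_contra! hrest
    refine hsph ⟨(γ t₀).symm q, fun a ha b hb => ?_⟩
    exact (sub_eq_zero.1 (hrest a ha)).trans (sub_eq_zero.1 (hrest b hb)).symm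
  have hne : subId (Kinematics.relative γ t₀ s).linearIsometryEquiv ≠ 0 := by
    intro h0
    refine hst (LinearIsometryEquiv.ext fun v => ?_)
    have h1 := LinearMap.congr_fun h0 ((γ t₀).linearIsometryEquiv v)
    rw [subId_apply, Kinematics.linear_relative, LinearIsometryEquiv.symm_apply_apply] at h1
    exact (sub_eq_zero.1 h1).symm
  obtain ⟨K, hK2, hK, c, hc⟩ := hfam.exists_fixed_plane hdet (by simp) hmove hs hne
  set b : ℝ → E4 := fun t => Kinematics.relative γ t₀ t c - c with hb
  have hbcont : ContinuousOn b I := hfam.continuousOn c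
  have hb0 : b t₀ = 0 := hfam.base c
  let ρ : ℝ → E4 ≃ᵃⁱ[ℝ] E4 := fun t =>
    (Kinematics.relative γ t₀ t).trans (AffineIsometryEquiv.constVAdd ℝ E4 (-b t))
  let σ : ℝ → E4 ≃ᵃⁱ[ℝ] E4 := fun t => AffineIsometryEquiv.constVAdd ℝ E4 (b t)
  have hρ : ∀ t x, ρ t x = Kinematics.relative γ t₀ t x - b t := fun t x =>
    neg_add_eq_sub _ _
  have hσ : ∀ t x, σ t x = x + b t := fun t x => add_comm _ _
  have hdir : (AffineSubspace.mk' c K).direction = K := AffineSubspace.direction_mk' c K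
  refine ⟨AffineSubspace.mk' c K, ρ, σ, γ t₀, by rw [hdir, hK2], hγ.displacement t₀ ht₀,
    ⟨⟨fun t ht => ?_, fun p => ?_⟩, fun t ht x hx => ?_, t₀, ht₀, s, hs, fun heq => ?_⟩,
    ⟨⟨fun t ht => ?_, fun p => ?_⟩, fun t ht => ⟨b t, ?_, hσ t⟩, fun p => ?_, ?_⟩,
    fun t ht p => ?_⟩
  · exact hdet t ht
  · simp only [hρ]
    exact (hγ.continuousOn _).sub hbcont
  · rw [AffineSubspace.mem_mk', vsub_eq_sub] at hx
    have h1 : Kinematics.relative γ t₀ t (c + (x - c)) - (c + (x - c)) =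
        b t + subId _ (x - c) := hfam.map_add t c (x - c)
    rw [hK t ht _ hx, add_zero, add_sub_cancel] at h1
    rw [hρ, ← h1, sub_sub_cancel]
  · refine hne (LinearMap.ext fun v => ?_)
    have h1 : ∀ t, ρ t (c + v) = c + v + subId (Kinematics.relative γ t₀ t).linearIsometryEquiv v :=
      fun t => by
        have : Kinematics.relative γ t₀ t (c + v) - (c + v) = b t + subId _ v :=
          hfam.map_add t c v
        rw [hρ, sub_eq_iff_eq_add.1 this]
        abel
    have h2 : ρ t₀ (c + v) = ρ s (c + v) := by rw [heq]
    rw [h1, h1, hfam.subId_base] at h2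
    exact (add_left_cancel h2).symm
  · change LinearMap.det (LinearMap.id : E4 →ₗ[ℝ] E4) = 1
    exact LinearMap.det_id
  · simp only [hσ]
    exact continuousOn_const.add hbcont
  · rw [hdir]
    exact hc t ht
  · -- the trajectory of `p` under `σ` is a translate of that of `c` under the original motion
    obtain ⟨C, ⟨m, D, r, hD, hr, rfl⟩, hC⟩ := hcirc ((γ t₀).symm c)
    refine ⟨_, ⟨m + (p - c), D, r, hD, hr, rfl⟩, ?_⟩
    rintro _ ⟨t, ht, rfl⟩
    have h1 : σ t p = Kinematics.relative γ t₀ t c + (p - c) := by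
      rw [hσ]
      change p + (Kinematics.relative γ t₀ t c - c) = _
      abel
    obtain ⟨h2, h3⟩ := hC ⟨t, ht, rfl⟩
    change σ t p - (m + (p - c)) ∈ D ∧ dist (σ t p) (m + (p - c)) = r
    rw [h1, dist_add_right, add_sub_add_right_eq_sub]
    exact ⟨h2, h3⟩
  · obtain ⟨t, ht, hct⟩ := hmove c
    refine ⟨t₀, ht₀, t, ht, fun heq => hct ?_⟩
    have h1 : σ t₀ 0 = σ t 0 := by rw [heq]
    rw [hσ, hσ, hb0, zero_add, zero_add] at h1
    exact h1.symm
  · rw [hσ, hρ, Kinematics.relative_apply, AffineIsometryEquiv.symm_apply_apply]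
    abel
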